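/- Let $k\ge 0$ be an integer and let $(E,\mathcal I)$ be a matroid $k$-parity constraint: there is a matroid $\mathcal M$ whose ground set is partitioned into finitely many disjoint sets $v(e)$, $e\in E$, each with at most $k$ elements, and $\mathcal I$ consists of all $S\subseteq E$ such that $\bigcup_{e\in S}v(e)$ is independent in $\mathcal M$. Let $f\colon 2^E\to\mathbb R_{\ge 0}$ be submodular and let $\varepsilon\in(0,1)$. Write $f(e\mid S)=f(S\cup\{e\})-f(S)$ and $f(T\mid S)=f(S\cup T)-f(S)$. For $\theta>0$ and $A\in\mathcal I$, a pair $S\subseteq E\setminus A$, $N\subseteq A$ is a $(\theta,\varepsilon)$-improvement for $A$ if $(A\cup S)\setminus N\in\mathcal I$ and one of the following holds: (1) $S=\{x\}$, $N=\emptyset$ and $f(x\mid A)\ge\theta$; (2) $S=\{x\}$, $N=\{y\}$, $f(x\mid A)\ge\theta$ and $f((A\cup\{x\})\setminus\{y\})\ge f(A)+\varepsilon\theta$; (3) $S=\{x_1,x_2\}$ with $x_1\ne x_2$, $N=\{y\}$, $f(x_1\mid A)\ge\theta$ and $f(x_2\mid A\cup\{x_1\})\ge\theta$, for at least one of the two labellings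 of $S$. Consider the following algorithm. Let $W=\max_{e\in E}f(e\mid\emptyset)$, draw $\alpha$ uniformly at random from $(0,1]$, and let $m_i=W2^{\alpha-i}$ for $i\ge 0$. Start with $i=0$ and $A_{\le 0}=\emptyset$. While there is an $e\in E\setminus A_{\le i}$ with $f(e\mid A_{\le i})>0$ and $A_{\le i}\cup\{e\}\in\mathcal I$: increase $i$ by $1$; let $A_i=\emptyset$; as long as there is an $(m_i,\varepsilon)$-improvement $(S,N)$ for $A_{\le i-1}\cup A_i$ with $N\subseteq A_i$, choose an arbitrary one (the choice may be randomized) and replace $A_i$ by $(A_i\setminus N)\cup S$; then let $A_{\le i}=A_{\le i-1}\cup A_i$. When the outer loop ends, return $A=A_{\le i}$. Then every execution of the algorithm terminates, and for every real $d\ge 2$ and every $O\in\mathcal I$ with $f(x\mid O\setminus\{x\})>0$ for all $x\in O$ (that is, every strictly down-monotone feasible $O$), the random output set $A$ satisfies $$(k+d+1+2\varepsilon)\cdot\mathbb E[f(A)]\ \ge\ d'\cdot f(O)+d\cdot\mathbb E[f(A\mid O)],\qquad d'=\frac{1-1/d}{2\ln 2}+\frac{d+1}{2d}.$$ -/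

import Mathlib

namespace MatroidParity

variable {E V : Type*}

/-- The marginal contribution `f(e ∣ S) = f(S + e) - f(S)` of an element. -/
def marg [DecidableEq E] (f : Finset E → ℝ) (e : E) (S : Finset E) : ℝ :=
  f (insert e S) - f S

/-- The marginal contribution `f(T ∣ S) = f(S ∪ T) - f(S)` of a set. -/
def margSet [DecidableEq E] (f : Finset E → ℝ) (T S : Finset E) : ℝ :=
  f (S ∪ T) - f S

/-- Submodularity, as diminishing marginal contributions. -/
def Submodular [DecidableEq E] (f : Finset E → ℝ) : Prop :=
  ∀ S T : Finset E, S ⊆ T → ∀ e, e ∉ T → marg f e T ≤ marg f e S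

/-- The data of a matroid `k`-parity constraint: the vertex sets `v e` of the edges `e : E` are
pairwise disjoint, have at most `k` elements each, and together make up the ground set of the
matroid `M`. (An edge without vertices is not excluded.) -/
structure IsParity (M : Matroid V) (v : E → Finset V) (k : ℕ) : Prop where
  disjoint : ∀ e e', e ≠ e' → Disjoint (v e) (v e')
  cover : ⋃ e, (v e : Set V) = M.E
  card_le : ∀ e, (v e).card ≤ k

/-- A set of edges is feasible if the union of its edges is independent in the matroid. -/
def Feasible (M : Matroid V) (v : E → Finset V) (S : Finset E) : Prop :=
  M.Indep (⋃ e ∈ S, (v e : Set V))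

/-- A set `O` is strictly down-monotone if `f(x ∣ O - x) > 0` for every `x ∈ O`. -/
def StrictlyDownMonotone [DecidableEq E] (f : Finset E → ℝ) (O : Finset E) : Prop :=
  ∀ x ∈ O, 0 < marg f x (O.erase x)

/-- `(S, N)` is a `(θ, ε)`-improvement for the set `A`, where `I` is the family of feasible
sets. -/
def IsImprovement [DecidableEq E] (f : Finset E → ℝ) (I : Finset E → Prop) (θ ε : ℝ)
    (A S N : Finset E) : Prop :=
  Disjoint S A ∧ N ⊆ A ∧ I ((A ∪ S) \ N) ∧
    ((∃ x, S = {x} ∧ N = ∅ ∧ θ ≤ marg f x A) ∨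
     (∃ x y, S = {x} ∧ N = {y} ∧ θ ≤ marg f x A ∧ f A + ε * θ ≤ f ((insert x A).erase y)) ∨
     (∃ x₁ x₂ y, x₁ ≠ x₂ ∧ S = {x₁, x₂} ∧ N = {y} ∧
        θ ≤ marg f x₁ A ∧ θ ≤ marg f x₂ (insert x₁ A)))

/-- `W = max_{e ∈ E} f(e ∣ ∅)` (with the irrelevant value `0` if there are no elements). -/
noncomputable def maxMarg [DecidableEq E] (f : Finset E → ℝ) : ℝ :=
  ⨆ e : E, marg f e ∅

/-- The threshold `m_i = W τ 2^{-i}` with `τ = 2^α`. -/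
noncomputable def threshold [DecidableEq E] (f : Finset E → ℝ) (α : ℝ) (i : ℕ) : ℝ :=
  maxMarg f * (2 : ℝ) ^ α / 2 ^ i

/-- The condition of the outer loop of the algorithm at the current set `B`. -/
def CanExtend [DecidableEq E] (f : Finset E → ℝ) (I : Finset E → Prop) (B : Finset E) : Prop :=
  ∃ e, e ∉ B ∧ 0 < marg f e B ∧ I (insert e B)

/-- The states of the algorithm: `outer i B` is the state in which the condition of the outer loop
is about to be checked after `i` iterations, with `B = A_{≤ i}`; `inner i B C` is the state in
which the condition of the inner loop is about to be checked in iteration `i`, with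
`B = A_{≤ i-1}` and `C` the current value of `A_i`. -/
inductive State (E : Type*) where
  | outer (i : ℕ) (B : Finset E) : State E
  | inner (i : ℕ) (B C : Finset E) : State E

/-- One step of the algorithm, for a given value of `α`. The improvement that is applied
is arbitrary. -/
inductive Step [DecidableEq E] (f : Finset E → ℝ) (I : Finset E → Prop) (ε α : ℝ) :
    State E → State E → Prop where
  | enter (i : ℕ) (B : Finset E) (h : CanExtend f I B) :
      Step f I ε α (State.outer i B) (State.inner (i + 1) B ∅)
  | improve (i : ℕ) (B C S N : Finset E)
      (h : IsImprovement f I (threshold f α i) ε (B ∪ C) S N) (hN : N ⊆ C) :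
      Step f I ε α (State.inner i B C) (State.inner i B ((C \ N) ∪ S))
  | leave (i : ℕ) (B C : Finset E)
      (h : ¬ ∃ S N, IsImprovement f I (threshold f α i) ε (B ∪ C) S N ∧ N ⊆ C) :
      Step f I ε α (State.inner i B C) (State.outer i (B ∪ C))

/-- `A` can be returned by an execution of the algorithm with the given value of `α`. -/
def IsOutput [DecidableEq E] (f : Finset E → ℝ) (I : Finset E → Prop) (ε α : ℝ)
    (A : Finset E) : Prop :=
  ∃ i, Relation.ReflTransGen (Step f I ε α) (State.outer 0 ∅) (State.outer i A) ∧
    ¬ CanExtend f I A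

/-- Every execution of the algorithm with the given value of `α` is finite. -/
def Terminates [DecidableEq E] (f : Finset E → ℝ) (I : Finset E → Prop) (ε α : ℝ) : Prop :=
  ¬ ∃ s : ℕ → State E, s 0 = State.outer 0 ∅ ∧ ∀ n, Step f I ε α (s n) (s (n + 1))

end MatroidParity

/-!
Order the elements of `O` and let the weight `w o` of `o ∈ O` be its marginal contribution to its
predecessors. While the algorithm runs, keep a set `X` of vertices of `O` that together with the
vertices of the current solution is independent. When iteration `i` adds a block `C`, at most
`k * #C` vertices have to leave `X`; each of them pays `m_i` to the element of `O` it belongs to.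
Since no improvement by a pair is left, a matroid exchange argument shows that at most `#C` elements
of `O` with marginal contribution at least `m_i` lose exactly one vertex; each of them gets another
`m_i`. As every element of `C` has contributed at least `m_i`, at most `(k + 1) * (f A - f ∅)` is
paid in total, and in the end every `o ∈ O` has received the smallest threshold above its marginal
contribution `u` to `A`, so at least `u`.

If the largest threshold below `w o` is `w o * 2 ^ (-s)`, then `o` receives at least
`w o * min (2 * 2 ^ (-s)) (d - (d - 1) * 2 ^ (-s))` from the payments plus `d * (w o - u)`, the
first term covering the case that this threshold is at most `u`. As `s` is uniform on `[0, 1)`, the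
average of the minimum is `d * logb 2 (1 + 1 / d)`.
-/

namespace MatroidParity

open Finset

section MatroidRank

variable {ι V : Type*} {M : Matroid V}

/-- The rank of a finite set in a matroid, as a natural number. -/
noncomputable def finRank (M : Matroid V) (s : Finset V) : ℕ := (M.eRk s).toNat

lemma coe_finRank (M : Matroid V) (s : Finset V) : (finRank M s : ℕ∞) = M.eRk s :=
  ENat.natCast_toNat (Matroid.eRk_ne_top_iff.2 (M.isRkFinite_of_finite s.finite_toSet))

lemma finRank_eq_card_of_isBasis {J s : Finset V} (h : M.IsBasis J s) : finRank M s = #J := by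
  have := h.eRk_eq_encard
  rw [← coe_finRank, Set.encard_coe_eq_coe_finsetCard] at this
  exact_mod_cast this

lemma finRank_eq_card_of_indep {s : Finset V} (h : M.Indep s) : finRank M s = #s :=
  finRank_eq_card_of_isBasis h.isBasis_self

lemma exists_finset_isBasis_of_indep {I s : Finset V} (hI : M.Indep I) (hIs : I ⊆ s)
    (hs : (s : Set V) ⊆ M.E) : ∃ J : Finset V, I ⊆ J ∧ M.IsBasis J s := by
  obtain ⟨J, hJ, hIJ⟩ := hI.subset_isBasis_of_subset (coe_subset.2 hIs) hs
  lift J to Finset V using s.finite_toSet.subset hJ.subset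
  exact ⟨J, coe_subset.1 hIJ, hJ⟩

lemma card_le_finRank {I s : Finset V} (hI : M.Indep I) (hIs : I ⊆ s) : #I ≤ finRank M s := by
  have := hI.encard_le_eRk_of_subset (coe_subset.2 hIs)
  rw [← coe_finRank, Set.encard_coe_eq_coe_finsetCard] at this
  exact_mod_cast this

variable [DecidableEq V]

lemma finRank_inter_add_finRank_union_le (M : Matroid V) (s t : Finset V) :
    finRank M (s ∩ t) + finRank M (s ∪ t) ≤ finRank M s + finRank M t := by
  have := M.eRk_inter_add_eRk_union_le s t
  simp only [← coe_inter, ← coe_union, ← coe_finRank] at this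
  exact_mod_cast this

lemma exists_indep_insert_pair {D I : Finset V} (hI : M.Indep I) (hD : (D : Set V) ⊆ M.E)
    (hrank : #I + 2 ≤ finRank M (D ∪ I)) :
    ∃ d₁ ∈ D, ∃ d₂ ∈ D, d₁ ≠ d₂ ∧ M.Indep (insert d₁ (insert d₂ I) : Finset V) := by
  obtain ⟨J, hIJ, hJ⟩ := exists_finset_isBasis_of_indep hI (subset_union_right (s₁ := D))
    (by rw [coe_union]; exact Set.union_subset hD hI.subset_ground)
  have hJD : J \ I ⊆ D := by
    have := coe_subset.1 hJ.subset
    grind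
  have hcard : 1 < #(J \ I) := by
    have := card_sdiff_add_card_eq_card hIJ
    have := finRank_eq_card_of_isBasis hJ
    lia
  obtain ⟨d₁, hd₁, d₂, hd₂, hne⟩ := one_lt_card.1 hcard
  refine ⟨d₁, hJD hd₁, d₂, hJD hd₂, hne, hJ.indep.subset (coe_subset.2 ?_)⟩
  exact insert_subset (mem_sdiff.1 hd₁).1 (insert_subset (mem_sdiff.1 hd₂).1 hIJ)

lemma sum_sub_sdiff_le_of_submodular {g : Finset V → ℤ}
    (hg : ∀ s t, g (s ∩ t) + g (s ∪ t) ≤ g s + g t) {U : ι → Finset V} {C : Finset ι}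
    (hU : (C : Set ι).PairwiseDisjoint U) (s : Finset V) :
    ∑ y ∈ C, (g s - g (s \ U y)) ≤ g s - g (s \ C.biUnion U) := by
  classical
  induction C using Finset.induction_on with
  | empty => simp
  | insert y C hy ih =>
    rw [coe_insert, Set.pairwiseDisjoint_insert_of_notMem (mod_cast hy)] at hU
    have hdisj : Disjoint (U y) (C.biUnion U) := (disjoint_biUnion_right _ _ _).2 hU.2
    have hinter : (s \ U y) ∩ (s \ C.biUnion U) = s \ (insert y C).biUnion U := by
      rw [biUnion_insert, sdiff_union_distrib]
    have hunion : (s \ U y) ∪ (s \ C.biUnion U) = s := by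
      rw [← sdiff_inter_distrib_right, disjoint_iff_inter_eq_empty.1 hdisj, sdiff_empty]
    have hsub := hg (s \ U y) (s \ C.biUnion U)
    rw [hinter, hunion] at hsub
    rw [sum_insert hy]
    linarith [ih hU.1]

/-- If no block could be exchanged for two elements of `D`, then deleting a block `U y` would
lower the rank of `D ∪ J` by at least `#(U y) - 1`. By submodularity, deleting all blocks would
lower it by at least `#(⋃ U) - #C`, but it is only lowered by `#(⋃ U) - #D`. -/
lemma exists_indep_exchange_pair {U : ι → Finset V} {C : Finset ι} {D J : Finset V}
    (hU : (C : Set ι).PairwiseDisjoint U) (hUJ : ∀ y ∈ C, U y ⊆ J) (hDJ : Disjoint D J)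
    (hJ : M.IsBasis J (D ∪ J : Finset V)) (hD : M.Indep (D ∪ J \ C.biUnion U : Finset V))
    (hcard : #C < #D) :
    ∃ y ∈ C, ∃ d₁ ∈ D, ∃ d₂ ∈ D, d₁ ≠ d₂ ∧
      M.Indep (insert d₁ (insert d₂ (J \ U y)) : Finset V) := by
  by_contra! hno
  have hDE : (D : Set V) ⊆ M.E := (coe_subset.2 subset_union_left).trans hD.subset_ground
  have hsdiff : ∀ T ⊆ J, (D ∪ J) \ T = D ∪ J \ T := fun T hT => by
    rw [union_sdiff_distrib, sdiff_eq_self_of_disjoint (hDJ.mono_right hT)]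
  have hblock : ∀ y ∈ C, (#(U y) : ℤ) - 1 ≤ finRank M (D ∪ J) - finRank M ((D ∪ J) \ U y) := by
    intro y hy
    have hlt : finRank M (D ∪ J \ U y) < #(J \ U y) + 2 := by
      by_contra! hle
      obtain ⟨d₁, hd₁, d₂, hd₂, hne, hind⟩ :=
        exists_indep_insert_pair (hJ.indep.subset (coe_subset.2 sdiff_subset)) hDE hle
      exact hno y hy d₁ hd₁ d₂ hd₂ hne hind
    have := card_sdiff_add_card_eq_card (hUJ y hy)
    rw [hsdiff _ (hUJ y hy), finRank_eq_card_of_isBasis hJ]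
    lia
  have hall : (finRank M (D ∪ J) : ℤ) - finRank M ((D ∪ J) \ C.biUnion U)
      = #(C.biUnion U) - #D := by
    have hUJ' : C.biUnion U ⊆ J := biUnion_subset.2 hUJ
    have := card_sdiff_add_card_eq_card hUJ'
    rw [hsdiff _ hUJ', finRank_eq_card_of_isBasis hJ, finRank_eq_card_of_indep hD,
      card_union_of_disjoint (hDJ.mono_right sdiff_subset)]
    lia
  have hsum := (sum_le_sum hblock).trans (sum_sub_sdiff_le_of_submodular
    (g := fun s => (finRank M s : ℤ))
    (fun s t => mod_cast finRank_inter_add_finRank_union_le M s t) hU (D ∪ J))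
  rw [hall, card_biUnion hU, sum_sub_distrib, sum_const, nsmul_one] at hsum
  push_cast at hsum
  lia

lemma exists_isBasis_union_sdiff {X Y Y' : Finset V} (hYX : M.Indep (Y ∪ X : Finset V))
    (hY' : M.Indep Y') (hYY' : Y ⊆ Y') :
    ∃ L, M.IsBasis (Y' ∪ X \ L : Finset V) (Y' ∪ X : Finset V) ∧ #L ≤ #(Y' \ Y) := by
  have hXE : (X : Set V) ⊆ M.E := (coe_subset.2 subset_union_right).trans hYX.subset_ground
  obtain ⟨J, hYJ, hJ⟩ := exists_finset_isBasis_of_indep hY' (subset_union_left (s₂ := X))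
    (by rw [coe_union]; exact Set.union_subset hY'.subset_ground hXE)
  have hJs : J ⊆ Y' ∪ X := coe_subset.1 hJ.subset
  have hJeq : Y' ∪ X \ (X \ J) = J := by
    rw [sdiff_sdiff_right_self, inf_eq_inter, union_inter_distrib_left, union_eq_right.2 hYJ,
      inter_eq_right.2 hJs]
  refine ⟨X \ J, by rwa [hJeq], ?_⟩
  have hle : #(Y ∪ X) ≤ #J := by
    rw [← finRank_eq_card_of_isBasis hJ]
    exact card_le_finRank hYX (union_subset_union_left hYY')
  calc #(X \ J) ≤ #((Y ∪ X) \ J) := card_le_card (sdiff_subset_sdiff subset_union_right subset_rfl)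
    _ ≤ #(J \ (Y ∪ X)) := card_sdiff_le_card_sdiff_iff.2 hle
    _ ≤ #(Y' \ Y) := card_le_card (by grind)

end MatroidRank

section Submodular

variable {E ι : Type*} [DecidableEq E] [LinearOrder ι] {f : Finset E → ℝ}

lemma marg_of_mem {e : E} {S : Finset E} (h : e ∈ S) : marg f e S = 0 := by
  simp [marg, insert_eq_of_mem h]

/-- The elements of `O` that precede `o` when `O` is sorted by the key `r`. -/
def earlier (r : E → ι) (O : Finset E) (o : E) : Finset E := {x ∈ O | r x < r o}

lemma earlier_subset_erase (r : E → ι) (O : Finset E) (o : E) : earlier r O o ⊆ O.erase o :=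
  fun _ hx => mem_erase.2
    ⟨fun h => (mem_filter.1 hx).2.ne (congrArg r h), (mem_filter.1 hx).1⟩

lemma sum_marg_union_earlier {r : E → ι} (hr : r.Injective) (f : Finset E → ℝ)
    (A O : Finset E) : ∑ o ∈ O, marg f o (A ∪ earlier r O o) = f (A ∪ O) - f A := by
  induction O using Finset.induction_on_max_value r with
  | empty => simp
  | insert a O ha hmax ih =>
    have hlast : earlier r (insert a O) a = O := by
      have : ∀ x ∈ O, r x < r a := fun x hx =>
        (hmax x hx).lt_of_ne (hr.ne (ne_of_mem_of_not_mem hx ha))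
      simp [earlier, filter_insert, filter_true_of_mem this]
    have hrest : ∀ o ∈ O, earlier r (insert a O) o = earlier r O o := fun o ho => by
      rw [earlier, filter_insert, if_neg (hmax o ho).not_gt, earlier]
    rw [sum_insert ha, hlast, sum_congr rfl fun o ho => by rw [hrest o ho], ih]
    simp [marg]

/-- `Grown f θ B A` says that `A` arises from `B` by adding elements one by one, each with marginal
contribution at least `θ`. -/
inductive Grown (f : Finset E → ℝ) (θ : ℝ) (B : Finset E) : Finset E → Prop where
  | refl : Grown f θ B B
  | insert (A : Finset E) (x : E) (hA : Grown f θ B A) (hx : x ∉ A) (h : θ ≤ marg f x A) :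
      Grown f θ B (insert x A)

namespace Grown

variable {θ : ℝ} {A B : Finset E}

lemma subset (h : Grown f θ B A) : B ⊆ A := by
  induction h with
  | refl => exact subset_rfl
  | insert A x _ _ _ ih => exact ih.trans (subset_insert _ _)

lemma erase (hf : Submodular f) (h : Grown f θ B A) {y : E} (hyB : y ∉ B) :
    Grown f θ B (A.erase y) := by
  induction h with
  | refl => rw [erase_eq_of_notMem hyB]; exact .refl
  | insert A x hA hx hm ih =>
    by_cases hxy : x = y
    · subst hxy; rwa [erase_insert hx]
    · rw [erase_insert_of_ne hxy]
      exact .insert _ _ ih (fun h => hx (mem_of_mem_erase h))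
        (hm.trans (hf _ _ (erase_subset _ _) _ hx))

lemma mul_card_le (h : Grown f θ B A) : θ * #(A \ B) ≤ f A - f B := by
  induction h with
  | refl => simp
  | insert A x hA hx hm ih =>
    rw [insert_sdiff_of_notMem _ (fun h => hx (hA.subset h)),
      card_insert_of_notMem (by simp [hx])]
    unfold marg at hm
    push_cast
    linarith

end Grown

end Submodular

section Improvement

variable {E : Type*} [DecidableEq E] {f : Finset E → ℝ} {I : Finset E → Prop} {ε θ : ℝ}

lemma union_improve_eq {B C S N : Finset E} (hBC : Disjoint B C)
    (hS : Disjoint S (B ∪ C)) (hN : N ⊆ C) : B ∪ ((C \ N) ∪ S) = ((B ∪ C) ∪ S) \ N := by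
  rw [union_sdiff_distrib, union_sdiff_distrib, sdiff_eq_self_of_disjoint (hBC.mono_right hN),
    sdiff_eq_self_of_disjoint (hS.mono_right (hN.trans subset_union_right)), union_assoc]

lemma IsImprovement.cases_eq {A S N : Finset E} (h : IsImprovement f I θ ε A S N) :
    (∃ x, x ∉ A ∧ (A ∪ S) \ N = insert x A ∧ θ ≤ marg f x A) ∨
    (∃ x y, x ∉ A ∧ N = {y} ∧ (A ∪ S) \ N = (insert x A).erase y ∧ θ ≤ marg f x A ∧
      f A + ε * θ ≤ f ((insert x A).erase y)) ∨
    (∃ x₁ x₂ y, x₁ ∉ A ∧ x₂ ∉ insert x₁ A ∧ N = {y} ∧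
      (A ∪ S) \ N = (insert x₂ (insert x₁ A)).erase y ∧
      θ ≤ marg f x₁ A ∧ θ ≤ marg f x₂ (insert x₁ A)) := by
  obtain ⟨hS, -, -, ⟨x, rfl, rfl, hx⟩ | ⟨x, y, rfl, rfl, hx, hy⟩ |
    ⟨x₁, x₂, y, hne, rfl, rfl, h₁, h₂⟩⟩ := h
  · exact .inl ⟨x, disjoint_singleton_left.1 hS, by grind, hx⟩
  · exact .inr (.inl ⟨x, y, disjoint_singleton_left.1 hS, rfl, by grind, hx, hy⟩)
  · rw [disjoint_insert_left, disjoint_singleton_left] at hS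
    exact .inr (.inr ⟨x₁, x₂, y, hS.1, by grind, rfl, by grind, h₁, h₂⟩)

/-- The current block `C` of the inner loop with threshold `θ`, on top of the set `B` built by the
previous iterations: what every sequence of improvements maintains. -/
structure IsBlock (f : Finset E → ℝ) (I : Finset E → Prop) (θ : ℝ) (B C : Finset E) : Prop where
  pos : 0 < θ
  disjoint : Disjoint B C
  feasible : I (B ∪ C)
  grown : Grown f θ B (B ∪ C)

/-- The condition under which the inner loop with threshold `θ` stops at the block `C` on top
of `B`. -/
def IsLocallyOptimal (f : Finset E → ℝ) (I : Finset E → Prop) (θ ε : ℝ) (B C : Finset E) : Prop :=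
  ¬ ∃ S N, IsImprovement f I θ ε (B ∪ C) S N ∧ N ⊆ C

lemma IsLocallyOptimal.marg_lt {B C : Finset E} (h : IsLocallyOptimal f I θ ε B C) {x : E}
    (hx : x ∉ B ∪ C) (hI : I (insert x (B ∪ C))) : marg f x (B ∪ C) < θ := by
  by_contra! hle
  refine h ⟨{x}, ∅, ⟨disjoint_singleton_left.2 hx, empty_subset _, ?_, .inl ⟨x, rfl, rfl, hle⟩⟩,
    empty_subset _⟩
  rwa [sdiff_empty, union_comm, ← insert_eq]

namespace IsBlock

variable {B C S N : Finset E}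

lemma improve (hf : Submodular f) (hC : IsBlock f I θ B C)
    (h : IsImprovement f I θ ε (B ∪ C) S N) (hN : N ⊆ C) : IsBlock f I θ B ((C \ N) ∪ S) where
  pos := hC.pos
  disjoint := disjoint_union_right.2 ⟨hC.disjoint.mono_right sdiff_subset,
    (h.1.mono_right subset_union_left).symm⟩
  feasible := by rw [union_improve_eq hC.disjoint h.1 hN]; exact h.2.2.1
  grown := by
    rw [union_improve_eq hC.disjoint h.1 hN]
    have hNB : ∀ y, N = {y} → y ∉ B := by
      rintro y rfl hyB
      exact disjoint_left.1 hC.disjoint hyB (singleton_subset_iff.1 hN)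
    rcases h.cases_eq with ⟨x, hx, heq, h₁⟩ | ⟨x, y, hx, hy, heq, h₁, -⟩ |
      ⟨x₁, x₂, y, hx₁, hx₂, hy, heq, h₁, h₂⟩ <;> rw [heq]
    · exact .insert _ _ hC.grown hx h₁
    · exact (Grown.insert _ _ hC.grown hx h₁).erase hf (hNB y hy)
    · exact (Grown.insert _ _ (.insert _ _ hC.grown hx₁ h₁) hx₂ h₂).erase hf (hNB y hy)

/-- An improvement of the third kind gains at least `2 * θ` and then gives up a single element,
which by submodularity is worth at most its marginal contribution to `B`. -/
lemma lt_improve (hf : Submodular f) (hε : 0 < ε) (hC : IsBlock f I θ B C)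
    (hlt : ∀ y ∈ C, marg f y B < 2 * θ) (h : IsImprovement f I θ ε (B ∪ C) S N) (hN : N ⊆ C) :
    f (B ∪ C) < f (B ∪ ((C \ N) ∪ S)) := by
  have hθ := hC.pos
  rw [union_improve_eq hC.disjoint h.1 hN]
  rcases h.cases_eq with ⟨x, -, heq, h₁⟩ | ⟨x, y, -, -, heq, -, h₂⟩ |
    ⟨x₁, x₂, y, -, -, rfl, heq, h₁, h₂⟩ <;> rw [heq]
  · unfold marg at h₁; linarith
  · have := mul_pos hε hθ; linarith
  · have hyC : y ∈ C := singleton_subset_iff.1 hN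
    set T := insert x₂ (insert x₁ (B ∪ C))
    have hT : B ∪ C ⊆ T := (subset_insert x₁ _).trans (subset_insert x₂ _)
    have hBT : B ⊆ T.erase y :=
      subset_erase.2 ⟨subset_union_left.trans hT, fun hyB => disjoint_left.1 hC.disjoint hyB hyC⟩
    have hloss : f T - f (T.erase y) ≤ marg f y B := by
      have := hf _ _ hBT y (notMem_erase y T)
      rwa [marg, insert_erase (hT (mem_union_right _ hyC))] at this
    have := hlt y hyC
    unfold marg at h₁ h₂ this hloss
    linarith

end IsBlock

end Improvement

section Threshold

variable {E : Type*} [DecidableEq E] {f : Finset E → ℝ} {I : Finset E → Prop} {α : ℝ}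

lemma marg_empty_le_maxMarg [Finite E] (f : Finset E → ℝ) (e : E) : marg f e ∅ ≤ maxMarg f :=
  le_ciSup (f := fun e => marg f e ∅) (Set.finite_range _).bddAbove e

lemma marg_le_maxMarg [Finite E] (hf : Submodular f) {e : E} {S : Finset E} (he : e ∉ S) :
    marg f e S ≤ maxMarg f :=
  (hf _ _ (empty_subset S) e he).trans (marg_empty_le_maxMarg f e)

lemma CanExtend.maxMarg_pos [Finite E] (hf : Submodular f) {B : Finset E}
    (h : CanExtend f I B) : 0 < maxMarg f := by
  obtain ⟨e, he, hpos, -⟩ := h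
  exact hpos.trans_le (marg_le_maxMarg hf he)

lemma threshold_eq_mul_rpow (f : Finset E → ℝ) (α : ℝ) (i : ℕ) :
    threshold f α i = maxMarg f * 2 ^ (α - i) := by
  rw [threshold, Real.rpow_sub two_pos, Real.rpow_natCast, mul_div_assoc]

lemma threshold_pos (hW : 0 < maxMarg f) (i : ℕ) : 0 < threshold f α i := by
  unfold threshold; positivity

lemma two_mul_threshold_succ (f : Finset E → ℝ) (α : ℝ) (i : ℕ) :
    2 * threshold f α (i + 1) = threshold f α i := by
  unfold threshold; rw [pow_succ]; field_simp

lemma threshold_antitone (hW : 0 < maxMarg f) : Antitone (threshold f α) :=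
  antitone_nat_of_succ_le fun i => by
    linarith [two_mul_threshold_succ f α i, threshold_pos (α := α) hW (i + 1)]

lemma tendsto_threshold (f : Finset E → ℝ) (α : ℝ) :
    Filter.Tendsto (threshold f α) Filter.atTop (nhds 0) :=
  tendsto_const_nhds.div_atTop (tendsto_pow_atTop_atTop_of_one_lt one_lt_two)

lemma eventually_threshold_lt_marg [Finite E] (f : Finset E → ℝ) (α : ℝ) :
    ∀ᶠ i in Filter.atTop, ∀ e B, 0 < marg f e B → threshold f α i < marg f e B := by
  simp only [Filter.eventually_all]
  exact fun e B hpos => (tendsto_threshold f α).eventually_lt_const hpos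

end Threshold

section Algorithm

variable {E : Type*} [DecidableEq E] {f : Finset E → ℝ} {I : Finset E → Prop} {ε α : ℝ}
  {R : ℕ → Finset E → Prop}

/-- A relation between the number of completed iterations and the current set that holds initially
and is preserved by every iteration of the outer loop. -/
structure OuterInvariant (f : Finset E → ℝ) (I : Finset E → Prop) (ε α : ℝ)
    (R : ℕ → Finset E → Prop) : Prop where
  init : R 0 ∅
  step : ∀ {i B C}, R i B → IsBlock f I (threshold f α (i + 1)) B C →
    IsLocallyOptimal f I (threshold f α (i + 1)) ε B C → R (i + 1) (B ∪ C)

/-- The extension of a relation `R` on outer states to all states of the algorithm: in an inner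
state, the last outer state satisfies `R` and the current set is a block on top of it. -/
def StateInv (f : Finset E → ℝ) (I : Finset E → Prop) (α : ℝ) (R : ℕ → Finset E → Prop) :
    State E → Prop
  | .outer i B => R i B
  | .inner i B C => ∃ j, i = j + 1 ∧ R j B ∧ IsBlock f I (threshold f α i) B C

lemma StateInv.step [Finite E] (hf : Submodular f) (hI : Antitone I)
    (hR : OuterInvariant f I ε α R) {s t : State E} (hs : StateInv f I α R s)
    (h : Step f I ε α s t) : StateInv f I α R t := by
  cases h with
  | enter i B h =>
    obtain ⟨e, -, -, he⟩ := id h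
    exact ⟨i, rfl, hs, threshold_pos (h.maxMarg_pos hf) _, disjoint_empty_right _,
      hI (by simp) he, by rw [union_empty]; exact .refl⟩
  | improve i B C S N h hN =>
    obtain ⟨j, hij, hRB, hC⟩ := hs
    exact ⟨j, hij, hRB, hC.improve hf h hN⟩
  | leave i B C h =>
    obtain ⟨j, rfl, hRB, hC⟩ := hs
    exact hR.step hRB hC h

lemma StateInv.of_reachable [Finite E] (hf : Submodular f) (hI : Antitone I)
    (hR : OuterInvariant f I ε α R) {s : State E}
    (h : Relation.ReflTransGen (Step f I ε α) (.outer 0 ∅) s) : StateInv f I α R s := by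
  induction h with
  | refl => exact hR.init
  | tail _ h ih => exact ih.step hf hI hR h

end Algorithm

section Termination

/-- The number of sets of larger value than `A`. -/
noncomputable def valueRank {E : Type*} (f : Finset E → ℝ) (A : Finset E) : ℕ :=
  {T | f A < f T}.ncard

lemma valueRank_lt {E : Type*} [Finite E] {f : Finset E → ℝ} {A A' : Finset E} (h : f A < f A') :
    valueRank f A' < valueRank f A :=
  Set.ncard_lt_ncard ⟨fun _ hT => h.trans hT, fun hsub => lt_irrefl (f A') (hsub h)⟩

variable {E : Type*} [DecidableEq E] {f : Finset E → ℝ} {I : Finset E → Prop} {ε α : ℝ}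

/-- An outer state in which every remaining improving element has marginal contribution below the
current threshold. -/
def Exhausted (f : Finset E → ℝ) (I : Finset E → Prop) (α : ℝ) (i : ℕ) (B : Finset E) : Prop :=
  ∀ y ∉ B, I (insert y B) → 0 < marg f y B → marg f y B < threshold f α i

lemma exhausted_zero [Finite E] (hα : 0 < α) : Exhausted f I α 0 ∅ := by
  intro y _ _ hpos
  have hW : 0 < maxMarg f := hpos.trans_le (marg_empty_le_maxMarg f y)
  refine (marg_empty_le_maxMarg f y).trans_lt ?_
  rw [threshold, pow_zero, div_one]
  exact lt_mul_of_one_lt_right hW (Real.one_lt_rpow one_lt_two hα)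

lemma outerInvariant_exhausted [Finite E] (hα : 0 < α) :
    OuterInvariant f I ε α (Exhausted f I α) where
  init := exhausted_zero hα
  step _ _ hopt _ hy hyI _ := hopt.marg_lt hy hyI

lemma Exhausted.marg_lt_two_mul (hI : Antitone I) {i : ℕ} {B C : Finset E}
    (hB : Exhausted f I α i B) (hC : IsBlock f I (threshold f α (i + 1)) B C) {y : E}
    (hy : y ∈ C) : marg f y B < 2 * threshold f α (i + 1) := by
  rcases le_or_gt (marg f y B) 0 with hle | hpos
  · linarith [hC.pos]
  · rw [two_mul_threshold_succ]
    refine hB y (fun hyB => disjoint_left.1 hC.disjoint hyB hy) (hI ?_ hC.feasible) hpos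
    exact insert_subset (mem_union_right _ hy) subset_union_left

/-- A quantity that decreases with every step of the algorithm, provided that the outer loop stops
after at most `L` iterations. -/
noncomputable def stateRank (f : Finset E → ℝ) (L : ℕ) : State E → ℕ ×ₗ ℕ
  | .outer i _ => toLex (L - i, 0)
  | .inner i B C => toLex (L - i, valueRank f (B ∪ C) + 1)

lemma stateRank_lt [Finite E] (hf : Submodular f) (hI : Antitone I) (hε : 0 < ε) {L : ℕ}
    (hL : ∀ i B, Exhausted f I α i B → CanExtend f I B → i < L) {s t : State E}
    (hs : StateInv f I α (Exhausted f I α) s) (h : Step f I ε α s t) :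
    stateRank f L t < stateRank f L s := by
  cases h with
  | enter i B h =>
    have := hL i B hs h
    exact Prod.Lex.toLex_lt_toLex.2 (.inl (by lia))
  | improve i B C S N h hN =>
    obtain ⟨j, rfl, hB, hC⟩ := hs
    have := valueRank_lt (hC.lt_improve hf hε (fun y hy => hB.marg_lt_two_mul hI hC hy) h hN)
    exact Prod.Lex.toLex_lt_toLex.2 (.inr ⟨rfl, by lia⟩)
  | leave i B C h => exact Prod.Lex.toLex_lt_toLex.2 (.inr ⟨rfl, Nat.succ_pos _⟩)

theorem terminates [Finite E] (hf : Submodular f) (hI : Antitone I) (hε : 0 < ε) (hα : 0 < α) :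
    Terminates f I ε α := by
  rintro ⟨s, hs₀, hs⟩
  obtain ⟨L, hL⟩ := Filter.eventually_atTop.1 (eventually_threshold_lt_marg f α)
  have hbound : ∀ i B, Exhausted f I α i B → CanExtend f I B → i < L := by
    rintro i B hB ⟨e, he, hpos, heI⟩
    by_contra! hle
    exact (hB e he heI hpos).not_gt (hL i hle e B hpos)
  have hreach : ∀ n, Relation.ReflTransGen (Step f I ε α) (.outer 0 ∅) (s n) := by
    intro n
    induction n with
    | zero => rw [hs₀]
    | succ n ih => exact ih.tail (hs n)
  obtain ⟨n, hn⟩ := WellFounded.not_rel_apply_succ (r := (· < ·)) fun n => stateRank f L (s n)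
  exact hn (stateRank_lt hf hI hε hbound
    (StateInv.of_reachable hf hI (outerInvariant_exhausted hα) (hreach n)) (hs n))

end Termination

section Exchange

variable {E V : Type*} {M : Matroid V} {v : E → Finset V}

lemma antitone_feasible (M : Matroid V) (v : E → Finset V) : Antitone (Feasible M v) :=
  fun _ _ h hT => hT.subset (Set.biUnion_subset_biUnion_left h)

variable [DecidableEq V]

lemma feasible_iff_indep_biUnion {S : Finset E} :
    Feasible M v S ↔ M.Indep (S.biUnion v : Finset V) := by
  simp [Feasible]

lemma card_inter_pos {o : E} {X L : Finset V} (hoX : v o ⊆ X) (hoL : ¬ v o ⊆ X \ L) :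
    0 < #(v o ∩ L) := by
  obtain ⟨z, hz, hzL⟩ := not_subset.1 hoL
  exact card_pos.2 ⟨z, by grind⟩

lemma card_image_eq_of_mem (hv : Pairwise (Function.onFun Disjoint v)) {Q : Finset E} {d : E → V}
    (hd : ∀ o ∈ Q, d o ∈ v o) : #(Q.image d) = #Q :=
  card_image_of_injOn fun o ho o' ho' h =>
    hv.eq (not_disjoint_iff.2 ⟨d o, hd o ho, h ▸ hd o' ho'⟩)

lemma disjoint_image_biUnion (hv : Pairwise (Function.onFun Disjoint v)) {Q A : Finset E}
    {d : E → V} (hd : ∀ o ∈ Q, d o ∈ v o) (hQA : Disjoint Q A) :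
    Disjoint (Q.image d) (A.biUnion v) := by
  simp only [disjoint_left, forall_mem_image, mem_biUnion, not_exists, not_and]
  intro o ho e he hde
  exact disjoint_left.1 hQA ho (hv.eq (not_disjoint_iff.2 ⟨d o, hd o ho, hde⟩) ▸ he)

variable [DecidableEq E]

lemma feasible_insert {B : Finset E} {X : Finset V} {o : E}
    (hX : M.Indep (B.biUnion v ∪ X : Finset V)) (ho : v o ⊆ X) : Feasible M v (insert o B) := by
  rw [feasible_iff_indep_biUnion, biUnion_insert]
  exact hX.subset (coe_subset.2 (union_subset (ho.trans subset_union_right) subset_union_left))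

lemma biUnion_exchange_subset (hv : Pairwise (Function.onFun Disjoint v)) {A : Finset E}
    {X L : Finset V} {o₁ o₂ y : E} {d₁ d₂ : V} (ho₁ : v o₁ ⊆ X) (hd₁ : v o₁ ∩ L = {d₁})
    (ho₂ : v o₂ ⊆ X) (hd₂ : v o₂ ∩ L = {d₂}) :
    ((A ∪ {o₁, o₂}) \ {y}).biUnion v ⊆
      insert d₁ (insert d₂ ((A.biUnion v ∪ X \ L) \ v y)) := by
  refine biUnion_subset.2 fun e he => ?_
  rw [mem_sdiff, notMem_singleton] at he
  have hey : Disjoint (v e) (v y) := hv he.2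
  have hsingle : ∀ {o d}, v o ⊆ X → v o ∩ L = {d} → v o ⊆ insert d (X \ L) :=
    fun hX hd z hz => by
      by_cases hzL : z ∈ L
      · exact mem_insert.2 (.inl (mem_singleton.1 (hd ▸ mem_inter.2 ⟨hz, hzL⟩)))
      · exact mem_insert_of_mem (mem_sdiff.2 ⟨hX hz, hzL⟩)
  have := hsingle ho₁ hd₁
  have := hsingle ho₂ hd₂
  have : v e ⊆ insert d₁ (insert d₂ (A.biUnion v ∪ X \ L)) := by grind
  grind [disjoint_left]

lemma exists_feasible_exchange (hv : Pairwise (Function.onFun Disjoint v)) {B C Q : Finset E}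
    {X L : Finset V} (hX : M.Indep (B.biUnion v ∪ X : Finset V))
    (hbasis : M.IsBasis ((B ∪ C).biUnion v ∪ X \ L : Finset V)
      ((B ∪ C).biUnion v ∪ X : Finset V))
    (hQ : Disjoint Q (B ∪ C)) (hQX : ∀ o ∈ Q, v o ⊆ X) (hQL : ∀ o ∈ Q, #(v o ∩ L) = 1)
    (hlt : #C < #Q) :
    ∃ y ∈ C, ∃ o₁ ∈ Q, ∃ o₂ ∈ Q, o₁ ≠ o₂ ∧ Feasible M v ((B ∪ C ∪ {o₁, o₂}) \ {y}) := by
  obtain ⟨o, ho⟩ := card_pos.1 (hlt.pos)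
  have : Nonempty V := (card_pos.1 (hQL o ho ▸ one_pos)).to_type
  choose! d hd using fun o ho => card_eq_one.1 (hQL o ho)
  have hdmem : ∀ o ∈ Q, d o ∈ v o ∩ L := fun o ho => by simp [hd o ho]
  have hdv : ∀ o ∈ Q, d o ∈ v o := fun o ho => (mem_inter.1 (hdmem o ho)).1
  have hDL : Q.image d ⊆ L := image_subset_iff.2 fun o ho => (mem_inter.1 (hdmem o ho)).2
  have hDX : Q.image d ⊆ X := image_subset_iff.2 fun o ho => hQX o ho (hdv o ho)
  set J := (B ∪ C).biUnion v ∪ X \ L with hJ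
  have hDJ : Disjoint (Q.image d) J := disjoint_union_right.2
    ⟨disjoint_image_biUnion hv hdv hQ, disjoint_sdiff.mono_left hDL⟩
  have hrest : Q.image d ∪ J \ C.biUnion v ⊆ B.biUnion v ∪ X := by
    rw [hJ, union_biUnion]
    grind
  obtain ⟨y, hy, d₁, hd₁, d₂, hd₂, hne, hind⟩ := exists_indep_exchange_pair (hv.set_pairwise _)
    (fun y hy => (subset_biUnion_of_mem v (mem_union_right B hy)).trans subset_union_left) hDJ
    (hbasis.isBasis_subset (coe_subset.2 subset_union_right) (coe_subset.2
      (union_subset (hDX.trans subset_union_right) (union_subset_union_right sdiff_subset))))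
    (hX.subset (coe_subset.2 hrest)) (card_image_eq_of_mem hv hdv ▸ hlt)
  obtain ⟨o₁, ho₁, rfl⟩ := mem_image.1 hd₁
  obtain ⟨o₂, ho₂, rfl⟩ := mem_image.1 hd₂
  exact ⟨y, hy, o₁, ho₁, o₂, ho₂, ne_of_apply_ne d hne, feasible_iff_indep_biUnion.2
    (hind.subset (coe_subset.2 (biUnion_exchange_subset hv (hQX o₁ ho₁) (hd o₁ ho₁)
      (hQX o₂ ho₂) (hd o₂ ho₂))))⟩

end Exchange

section Charging

variable {E V ι : Type*} [DecidableEq E] [LinearOrder ι] {M : Matroid V} {v : E → Finset V}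
  {f : Finset E → ℝ} {r : E → ι} {ε α θ : ℝ} {O : Finset E}

lemma notMem_union_earlier {A : Finset E} {o : E} (ho : o ∉ A) : o ∉ A ∪ earlier r O o :=
  fun h => (mem_union.1 h).elim ho fun h => notMem_erase o O (earlier_subset_erase r O o h)

lemma isImprovement_pair (hf : Submodular f) {I : Finset E → Prop} {A : Finset E} {x₁ x₂ y : E}
    (hx₁ : x₁ ∈ O) (hx₁A : x₁ ∉ A) (hx₂A : x₂ ∉ A) (hr : r x₁ < r x₂) (hy : y ∈ A)
    (hI : I ((A ∪ {x₁, x₂}) \ {y})) (h₁ : θ ≤ marg f x₁ (A ∪ earlier r O x₁))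
    (h₂ : θ ≤ marg f x₂ (A ∪ earlier r O x₂)) :
    IsImprovement f I θ ε A {x₁, x₂} {y} := by
  have hx₁₂ : x₁ ∈ earlier r O x₂ := mem_filter.2 ⟨hx₁, hr⟩
  refine ⟨by simp [hx₁A, hx₂A], singleton_subset_iff.2 hy, hI,
    .inr (.inr ⟨x₁, x₂, y, fun h => hr.ne (congrArg r h), rfl, rfl, ?_, ?_⟩)⟩
  · exact h₁.trans (hf _ _ subset_union_left _ (notMem_union_earlier hx₁A))
  · exact h₂.trans (hf _ _ (insert_subset (mem_union_right _ hx₁₂) subset_union_left) _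
      (notMem_union_earlier hx₂A))

variable [DecidableEq V]

/-- The elements of `O` whose marginal contribution to `A` is at least `θ` and that lose exactly
one of their vertices when the set `L` is removed from `X`. -/
noncomputable def singlyDisplaced (v : E → Finset V) (f : Finset E → ℝ) (r : E → ι) (θ : ℝ)
    (O A : Finset E) (X L : Finset V) : Finset E :=
  {o ∈ O | o ∉ A ∧ θ ≤ marg f o (A ∪ earlier r O o) ∧ v o ⊆ X ∧ #(v o ∩ L) = 1}

lemma card_singlyDisplaced_le (hv : Pairwise (Function.onFun Disjoint v)) (hf : Submodular f)
    (hr : r.Injective) {B C : Finset E} {X L : Finset V}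
    (hX : M.Indep (B.biUnion v ∪ X : Finset V))
    (hbasis : M.IsBasis ((B ∪ C).biUnion v ∪ X \ L : Finset V)
      ((B ∪ C).biUnion v ∪ X : Finset V))
    (hopt : IsLocallyOptimal f (Feasible M v) θ ε B C) :
    #(singlyDisplaced v f r θ O (B ∪ C) X L) ≤ #C := by
  by_contra! hlt
  have hmem : ∀ o ∈ singlyDisplaced v f r θ O (B ∪ C) X L, o ∈ O ∧ o ∉ B ∪ C ∧
      θ ≤ marg f o (B ∪ C ∪ earlier r O o) ∧ v o ⊆ X ∧ #(v o ∩ L) = 1 :=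
    fun o ho => mem_filter.1 ho
  obtain ⟨y, hy, o₁, ho₁, o₂, ho₂, hne, hfeas⟩ := exists_feasible_exchange hv hX hbasis
    (disjoint_left.2 fun o ho => (hmem o ho).2.1) (fun o ho => (hmem o ho).2.2.2.1)
    (fun o ho => (hmem o ho).2.2.2.2) hlt
  obtain ⟨ho₁O, ho₁A, hm₁, -⟩ := hmem o₁ ho₁
  obtain ⟨ho₂O, ho₂A, hm₂, -⟩ := hmem o₂ ho₂
  have hyA : y ∈ B ∪ C := mem_union_right _ hy
  have hyC : {y} ⊆ C := singleton_subset_iff.2 hy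
  rcases (hr.ne hne).lt_or_gt with hlt | hlt
  · exact hopt ⟨_, _, isImprovement_pair hf ho₁O ho₁A ho₂A hlt hyA hfeas hm₁ hm₂, hyC⟩
  · rw [pair_comm] at hfeas
    exact hopt ⟨_, _, isImprovement_pair hf ho₂O ho₂A ho₁A hlt hyA hfeas hm₂ hm₁, hyC⟩

/-- The number of units, each worth the current threshold, that `o` receives when the vertices in
`L` are displaced: one for each of its displaced vertices, and one more if it belongs to `Q`. -/
def share (v : E → Finset V) (L : Finset V) (Q : Finset E) (o : E) : ℕ :=
  #(v o ∩ L) + if o ∈ Q then 1 else 0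

lemma sum_share_le (hv : Pairwise (Function.onFun Disjoint v)) (L : Finset V) {Q : Finset E}
    (hQ : Q ⊆ O) : ∑ o ∈ O, share v L Q o ≤ #L + #Q := by
  have hL : ∑ o ∈ O, #(v o ∩ L) ≤ #L := by
    rw [← card_biUnion fun a _ b _ hab => (hv hab).mono inter_subset_left inter_subset_left]
    exact card_le_card (biUnion_subset.2 fun _ _ => inter_subset_right)
  simp only [share, sum_add_distrib, sum_boole, filter_mem_eq_inter, inter_eq_right.2 hQ,
    Nat.cast_id]
  lia

lemma two_le_share {A : Finset E} {o : E} {X L : Finset V} (ho : o ∈ O) (hoA : o ∉ A)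
    (hm : θ ≤ marg f o (A ∪ earlier r O o)) (hoX : v o ⊆ X) (hoL : ¬ v o ⊆ X \ L) :
    2 ≤ share v L (singlyDisplaced v f r θ O A X L) o := by
  have hpos := card_inter_pos hoX hoL
  rw [share]
  by_cases hone : #(v o ∩ L) = 1
  · have : o ∈ singlyDisplaced v f r θ O A X L := mem_filter.2 ⟨ho, hoA, hm, hoX, hone⟩
    rw [if_pos this]
    lia
  · lia

/-- A distribution `p` to the elements of `O` of `k + 1` times the value gained by the solution `B`
after `i` iterations. The vertices in `X` are those not yet displaced: an element that lost a vertex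
has received the current threshold, and one whose marginal contribution is at least a threshold used
so far has received twice that threshold. -/
structure IsPayment (M : Matroid V) (v : E → Finset V) (k : ℕ) (f : Finset E → ℝ) (α : ℝ)
    (r : E → ι) (O : Finset E) (i : ℕ) (B : Finset E) (X : Finset V) (p : E → ℝ) : Prop where
  indep : M.Indep (B.biUnion v ∪ X : Finset V)
  nonneg : ∀ o, 0 ≤ p o
  sum_le : ∑ o ∈ O, p o ≤ (k + 1) * (f B - f ∅)
  le_of_displaced : ∀ o ∈ O, o ∉ B → ¬ v o ⊆ X → threshold f α i ≤ p o
  le_of_large : ∀ o ∈ O, o ∉ B → ∀ j < i,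
    threshold f α (j + 1) ≤ marg f o (B ∪ earlier r O o) → threshold f α j ≤ p o

lemma isPayment_zero (k : ℕ) (f : Finset E → ℝ) (α : ℝ) (r : E → ι) (hO : Feasible M v O) :
    IsPayment M v k f α r O 0 ∅ (O.biUnion v) 0 where
  indep := by rw [biUnion_empty, empty_union]; exact feasible_iff_indep_biUnion.1 hO
  nonneg _ := le_rfl
  sum_le := by simp
  le_of_displaced _ ho _ h := absurd (subset_biUnion_of_mem v ho) h
  le_of_large _ _ _ _ hj := absurd hj (Nat.not_lt_zero _)

namespace IsPayment

variable {k i : ℕ} {B C : Finset E} {X L : Finset V} {p : E → ℝ} {Q : Finset E}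

lemma sum_add_share_le (hv : IsParity M v k) (hp : IsPayment M v k f α r O i B X p)
    (hC : IsBlock f (Feasible M v) θ B C)
    (hL : #L ≤ #((B ∪ C).biUnion v \ B.biUnion v)) (hQO : Q ⊆ O) (hQC : #Q ≤ #C) :
    ∑ o ∈ O, (p o + θ * share v L Q o) ≤ (k + 1) * (f (B ∪ C) - f ∅) := by
  have hLC : #L ≤ #C * k := by
    rw [union_biUnion, union_sdiff_left] at hL
    exact hL.trans ((card_le_card sdiff_subset).trans
      (card_biUnion_le_card_mul C v k fun e _ => hv.card_le e))
  have hshare : ∑ o ∈ O, share v L Q o ≤ #C * k + #C :=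
    (sum_share_le (fun _ _ h => hv.disjoint _ _ h) L hQO).trans (add_le_add hLC hQC)
  have hgain : θ * #C ≤ f (B ∪ C) - f B := by
    have := hC.grown.mul_card_le
    rwa [union_sdiff_cancel_left hC.disjoint] at this
  calc ∑ o ∈ O, (p o + θ * share v L Q o)
      = ∑ o ∈ O, p o + θ * (∑ o ∈ O, share v L Q o : ℕ) := by
        rw [sum_add_distrib, Nat.cast_sum, mul_sum]
    _ ≤ (k + 1) * (f B - f ∅) + θ * (#C * k + #C : ℕ) :=
        add_le_add hp.sum_le (mul_le_mul_of_nonneg_left (mod_cast hshare) hC.pos.le)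
    _ = (k + 1) * (f B - f ∅) + (k + 1) * (θ * #C) := by push_cast; ring
    _ ≤ (k + 1) * (f B - f ∅) + (k + 1) * (f (B ∪ C) - f B) := by gcongr
    _ = (k + 1) * (f (B ∪ C) - f ∅) := by ring

lemma le_add_share_of_displaced (hp : IsPayment M v k f α r O i B X p)
    (hpos : 0 < threshold f α (i + 1)) {o : E} (ho : o ∈ O) (hoB : o ∉ B)
    (hoL : ¬ v o ⊆ X \ L) :
    threshold f α (i + 1) ≤ p o + threshold f α (i + 1) * share v L Q o := by
  have hpo := hp.nonneg o
  by_cases hoX : v o ⊆ X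
  · have : 1 ≤ share v L Q o := (card_inter_pos hoX hoL).trans_le (Nat.le_add_right _ _)
    have := le_mul_of_one_le_right hpos.le (Nat.one_le_cast (α := ℝ).2 this)
    linarith
  · have := hp.le_of_displaced o ho hoB hoX
    rw [← two_mul_threshold_succ] at this
    have : 0 ≤ threshold f α (i + 1) * share v L Q o := by positivity
    linarith

lemma le_add_share_of_large (hf : Submodular f) (hp : IsPayment M v k f α r O i B X p)
    (hpos : 0 < threshold f α (i + 1)) (hind : M.Indep ((B ∪ C).biUnion v ∪ X \ L : Finset V))
    (hopt : IsLocallyOptimal f (Feasible M v) (threshold f α (i + 1)) ε B C) {o : E} (ho : o ∈ O)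
    (hoA : o ∉ B ∪ C) {j : ℕ} (hj : j < i + 1)
    (hm : threshold f α (j + 1) ≤ marg f o (B ∪ C ∪ earlier r O o)) :
    threshold f α j ≤ p o + threshold f α (i + 1) *
      share v L (singlyDisplaced v f r (threshold f α (i + 1)) O (B ∪ C) X L) o := by
  have hoB : o ∉ B := fun h => hoA (mem_union_left _ h)
  have hmarg := notMem_union_earlier (r := r) (O := O) hoA
  set s := share v L (singlyDisplaced v f r (threshold f α (i + 1)) O (B ∪ C) X L) o with hs
  have hterm : 0 ≤ threshold f α (i + 1) * s := by positivity
  rcases Nat.lt_succ_iff_lt_or_eq.1 hj with hj | rfl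
  · have hle : marg f o (B ∪ C ∪ earlier r O o) ≤ marg f o (B ∪ earlier r O o) :=
      hf _ _ (union_subset_union_left subset_union_left) o hmarg
    linarith [hp.le_of_large o ho hoB j hj (hm.trans hle)]
  by_cases hoX : v o ⊆ X
  · have hoL : ¬ v o ⊆ X \ L := fun h =>
      (hm.trans (hf _ _ subset_union_left o hmarg)).not_gt
        (hopt.marg_lt hoA (feasible_insert hind h))
    have : (2 : ℝ) ≤ s := mod_cast two_le_share ho hoA hm hoX hoL
    have := mul_le_mul_of_nonneg_left this hpos.le
    linarith [hp.nonneg o, two_mul_threshold_succ f α j]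
  · linarith [hp.le_of_displaced o ho hoB hoX]

end IsPayment

lemma outerInvariant_isPayment {k : ℕ} (hv : IsParity M v k) (hf : Submodular f)
    (hr : r.Injective) (hO : Feasible M v O) :
    OuterInvariant f (Feasible M v) ε α fun i B => ∃ X p, IsPayment M v k f α r O i B X p where
  init := ⟨_, _, isPayment_zero k f α r hO⟩
  step := by
    rintro i B C ⟨X, p, hp⟩ hC hopt
    obtain ⟨L, hbasis, hL⟩ := exists_isBasis_union_sdiff hp.indep
      (feasible_iff_indep_biUnion.1 hC.feasible)
      (biUnion_subset_biUnion_of_subset_left v subset_union_left)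
    have hQC := card_singlyDisplaced_le (O := O) (fun _ _ h => hv.disjoint _ _ h) hf hr hp.indep
      hbasis hopt
    have hpos := hC.pos
    refine ⟨X \ L, _, hbasis.indep, fun o => add_nonneg (hp.nonneg o) ?_,
      hp.sum_add_share_le hv hC hL (filter_subset _ _) hQC, ?_, ?_⟩
    · positivity
    · exact fun o ho hoA hoL =>
        hp.le_add_share_of_displaced hpos ho (fun h => hoA (mem_union_left _ h)) hoL
    · exact fun o ho hoA j hj hm =>
        hp.le_add_share_of_large hf hpos hbasis.indep hopt ho hoA hj hm

end Charging

section Rounding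

/-- A lower bound on what an element of weight `1` receives plus `d` times the loss of its marginal
contribution, when the largest threshold below its weight is `2 ^ (-s)`. -/
noncomputable def guaranteedShare (d s : ℝ) : ℝ :=
  min (2 * (2 : ℝ) ^ (-s)) (d - (d - 1) * (2 : ℝ) ^ (-s))

variable {E : Type*} [DecidableEq E] {f : Finset E → ℝ} {α : ℝ}

lemma exists_threshold_succ_eq {x : ℝ} (hx : 0 < x) (hxW : x ≤ maxMarg f) (hα : 0 < α) :
    ∃ j, threshold f α (j + 1) =
      x * (2 : ℝ) ^ (-Int.fract (Real.logb 2 (x / maxMarg f) - α)) := by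
  have hW : 0 < maxMarg f := hx.trans_le hxW
  set c := Real.logb 2 (x / maxMarg f) - α with hc
  have hlog : Real.logb 2 (x / maxMarg f) ≤ 0 :=
    Real.logb_nonpos one_lt_two (by positivity) ((div_le_one hW).2 hxW)
  obtain ⟨j, hj⟩ : ∃ j : ℕ, ⌊c⌋ = -(j + 1) := by
    have : ⌊c⌋ < 0 := Int.floor_lt.2 (by push_cast; linarith)
    exact ⟨(-⌊c⌋ - 1).toNat, by lia⟩
  have hexp : -Int.fract c = α - (j + 1 : ℕ) - Real.logb 2 (x / maxMarg f) := by
    rw [Int.fract, hj, hc]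
    push_cast
    ring
  refine ⟨j, ?_⟩
  rw [threshold_eq_mul_rpow, hexp, Real.rpow_sub two_pos _ (Real.logb _ _),
    Real.rpow_logb two_pos (by norm_num) (by positivity)]
  field_simp

lemma le_of_forall_threshold {u p : ℝ} (huW : u ≤ maxMarg f) (hα : 0 < α) (hp : 0 ≤ p)
    (h : ∀ j, threshold f α (j + 1) ≤ u → threshold f α j ≤ p) : u ≤ p := by
  rcases le_or_gt u 0 with hu | hu
  · exact hu.trans hp
  obtain ⟨j, hj⟩ := exists_threshold_succ_eq hu huW hα
  set t := Int.fract (Real.logb 2 (u / maxMarg f) - α)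
  have hle : (2 : ℝ) ^ (-t) ≤ 1 :=
    Real.rpow_le_one_of_one_le_of_nonpos one_le_two (neg_nonpos.2 (Int.fract_nonneg _))
  have hhalf : (2 : ℝ)⁻¹ ≤ 2 ^ (-t) := by
    rw [← Real.rpow_neg_one]
    exact Real.rpow_le_rpow_of_exponent_le one_le_two (neg_le_neg (Int.fract_lt_one _).le)
  calc u = 2 * (u * 2⁻¹) := by ring
    _ ≤ 2 * (u * 2 ^ (-t)) := by gcongr
    _ = threshold f α j := by rw [← hj, two_mul_threshold_succ]
    _ ≤ p := h j (hj.trans_le (mul_le_of_le_one_right hu.le hle))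

lemma mul_guaranteedShare_le {d u w p : ℝ} (hd : 1 ≤ d) (huw : u ≤ w) (hw : 0 < w)
    (hwW : w ≤ maxMarg f) (hα : 0 < α) (hp : 0 ≤ p)
    (h : ∀ j, threshold f α (j + 1) ≤ u → threshold f α j ≤ p) :
    w * guaranteedShare d (Int.fract (Real.logb 2 (w / maxMarg f) - α)) ≤ p + d * (w - u) := by
  obtain ⟨j, hj⟩ := exists_threshold_succ_eq hw hwW hα
  set s := Int.fract (Real.logb 2 (w / maxMarg f) - α)
  rw [guaranteedShare, mul_min_of_nonneg _ _ hw.le]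
  rcases le_or_gt (threshold f α (j + 1)) u with hu | hu
  · refine (min_le_left _ _).trans ?_
    calc w * (2 * 2 ^ (-s)) = threshold f α j := by rw [← two_mul_threshold_succ, hj]; ring
      _ ≤ p := h j hu
      _ ≤ p + d * (w - u) :=
        le_add_of_nonneg_right (mul_nonneg (by linarith) (sub_nonneg.2 huw))
  · refine (min_le_right _ _).trans ?_
    have hup := le_of_forall_threshold (huw.trans hwW) hα hp h
    calc w * (d - (d - 1) * 2 ^ (-s)) = d * w - (d - 1) * threshold f α (j + 1) := by
          rw [hj]; ring
      _ ≤ d * w - (d - 1) * u := by gcongr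
      _ ≤ p + d * (w - u) := by linarith

end Rounding

section Average

open MeasureTheory

lemma continuous_two_rpow_neg : Continuous fun s : ℝ => (2 : ℝ) ^ (-s) :=
  (Real.continuous_const_rpow two_ne_zero).comp continuous_neg

lemma continuous_guaranteedShare (d : ℝ) : Continuous (guaranteedShare d) := by
  have := continuous_two_rpow_neg
  unfold guaranteedShare
  fun_prop

lemma integral_two_rpow_neg (a b : ℝ) :
    ∫ s in a..b, (2 : ℝ) ^ (-s) = ((2 : ℝ) ^ (-a) - (2 : ℝ) ^ (-b)) / Real.log 2 := by
  have hlog : Real.log 2 ≠ 0 := (Real.log_pos one_lt_two).ne'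
  have hderiv : ∀ x ∈ Set.uIcc a b,
      HasDerivAt (fun s : ℝ => -(2 : ℝ) ^ (-s) / Real.log 2) ((2 : ℝ) ^ (-x)) x := fun x _ =>
    (((hasDerivAt_neg x).const_rpow two_pos).neg.div_const (Real.log 2)).congr_deriv
      (by field_simp)
  rw [intervalIntegral.integral_eq_sub_of_hasDerivAt hderiv
    (continuous_two_rpow_neg.intervalIntegrable a b)]
  ring

lemma logb_two_one_add_one_div_le_one {d : ℝ} (hd : 1 ≤ d) : Real.logb 2 (1 + 1 / d) ≤ 1 := by
  rw [Real.logb_le_iff_le_rpow one_lt_two (by positivity), Real.rpow_one]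
  linarith [(div_le_one (by linarith)).2 hd]

lemma integral_guaranteedShare {d : ℝ} (hd : 1 ≤ d) :
    ∫ s in (0 : ℝ)..1, guaranteedShare d s = d * Real.logb 2 (1 + 1 / d) := by
  have : 0 < d := by linarith
  set s₀ := Real.logb 2 (1 + 1 / d)
  have hpow : (2 : ℝ) ^ (-s₀) = d / (d + 1) := by
    rw [Real.rpow_neg zero_le_two, Real.rpow_logb two_pos (by norm_num) (by positivity)]
    field_simp
  have hs0 : 0 ≤ s₀ := Real.logb_nonneg one_lt_two (by simp [this.le])
  have hs1 : s₀ ≤ 1 := logb_two_one_add_one_div_le_one hd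
  have hleft : ∫ s in (0 : ℝ)..s₀, guaranteedShare d s =
      ∫ s in (0 : ℝ)..s₀, (d - (d - 1) * (2 : ℝ) ^ (-s)) := by
    refine intervalIntegral.integral_congr fun s hs => min_eq_right ?_
    rw [Set.uIcc_of_le hs0] at hs
    have : d / (d + 1) ≤ (2 : ℝ) ^ (-s) :=
      hpow ▸ Real.rpow_le_rpow_of_exponent_le one_le_two (neg_le_neg hs.2)
    rw [div_le_iff₀ (by linarith)] at this
    linarith
  have hright : ∫ s in s₀..1, guaranteedShare d s = ∫ s in s₀..1, 2 * (2 : ℝ) ^ (-s) := by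
    refine intervalIntegral.integral_congr fun s hs => min_eq_left ?_
    rw [Set.uIcc_of_le hs1] at hs
    have : (2 : ℝ) ^ (-s) ≤ d / (d + 1) :=
      hpow ▸ Real.rpow_le_rpow_of_exponent_le one_le_two (neg_le_neg hs.1)
    rw [le_div_iff₀ (by linarith)] at this
    linarith
  rw [← intervalIntegral.integral_add_adjacent_intervals
      ((continuous_guaranteedShare d).intervalIntegrable 0 s₀)
      ((continuous_guaranteedShare d).intervalIntegrable s₀ 1), hleft, hright,
    intervalIntegral.integral_sub intervalIntegrable_const
      ((continuous_two_rpow_neg.intervalIntegrable _ _).const_mul _),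
    intervalIntegral.integral_const_mul, intervalIntegral.integral_const_mul,
    integral_two_rpow_neg, integral_two_rpow_neg, intervalIntegral.integral_const, hpow,
    neg_zero, Real.rpow_zero, Real.rpow_neg_one, smul_eq_mul]
  field_simp
  ring

lemma approximation_factor_le {d : ℝ} (hd : 2 ≤ d) :
    (1 - 1 / d) / (2 * Real.log 2) + (d + 1) / (2 * d) ≤ d * Real.logb 2 (1 + 1 / d) := by
  have : 0 < d := by linarith
  have hlog : 0 < Real.log 2 := Real.log_pos one_lt_two
  have hlog_le : 2 / (2 * d + 1) ≤ Real.log (1 + 1 / d) := by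
    refine le_trans (le_of_eq ?_) (Real.le_log_one_add_of_nonneg (by positivity))
    field_simp
    ring
  have hnum : (d - 1) + (d + 1) * Real.log 2 ≤ 2 * d ^ 2 * (2 / (2 * d + 1)) := by
    rw [mul_div_assoc', le_div_iff₀ (by linarith)]
    nlinarith [Real.log_two_lt_d9]
  calc (1 - 1 / d) / (2 * Real.log 2) + (d + 1) / (2 * d)
      = ((d - 1) + (d + 1) * Real.log 2) / (2 * d * Real.log 2) := by field_simp
    _ ≤ (2 * d ^ 2 * Real.log (1 + 1 / d)) / (2 * d * Real.log 2) := by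
        gcongr
        exact hnum.trans (mul_le_mul_of_nonneg_left hlog_le (by positivity))
    _ = d * Real.logb 2 (1 + 1 / d) := by rw [Real.logb]; field_simp

lemma intervalIntegral_comp_fract_sub (g : ℝ → ℝ) (c : ℝ) :
    ∫ x in (0 : ℝ)..1, g (Int.fract (c - x)) = ∫ x in (0 : ℝ)..1, g x := by
  have hper : Function.Periodic (fun x : ℝ => g (Int.fract x)) 1 := fun x => by
    simp only [Int.fract_add_one]
  have hshift := hper.intervalIntegral_add_eq (c - 1) 0
  rw [sub_add_cancel, zero_add] at hshift
  rw [intervalIntegral.integral_comp_sub_left (fun x => g (Int.fract x)) c, sub_zero, hshift,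
    intervalIntegral.integral_of_le zero_le_one, intervalIntegral.integral_of_le zero_le_one,
    ← integral_Ico_eq_integral_Ioc, ← integral_Ico_eq_integral_Ioc]
  exact setIntegral_congr_fun measurableSet_Ico fun x hx =>
    congrArg g (Int.fract_eq_self.2 hx)

variable {Ω : Type*} [MeasurableSpace Ω] {P : Measure Ω} {α : Ω → ℝ}

lemma map_eq_restrict_of_isUniform (hα : pdf.IsUniform α (Set.Ioc 0 1) P volume) :
    P.map α = (volume : Measure ℝ).restrict (Set.Ioc 0 1) := by
  rw [pdf.IsUniform] at hα
  rw [hα, ProbabilityTheory.cond]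
  simp

lemma aemeasurable_of_isUniform (hα : pdf.IsUniform α (Set.Ioc 0 1) P volume) :
    AEMeasurable α P :=
  pdf.IsUniform.aemeasurable (μ := volume) (by simp) (by simp) hα

lemma ae_pos_of_isUniform (hα : pdf.IsUniform α (Set.Ioc 0 1) P volume) : ∀ᵐ ω ∂P, 0 < α ω := by
  refine ae_of_ae_map (p := fun x => 0 < x) (aemeasurable_of_isUniform hα) ?_
  rw [map_eq_restrict_of_isUniform hα]
  filter_upwards [ae_restrict_mem measurableSet_Ioc] with x hx using hx.1

lemma integral_comp_fract_sub_of_isUniform (hα : pdf.IsUniform α (Set.Ioc 0 1) P volume)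
    {g : ℝ → ℝ} (hg : Measurable g) (c : ℝ) :
    ∫ ω, g (Int.fract (c - α ω)) ∂P = ∫ x in (0 : ℝ)..1, g x := by
  have hm : Measurable fun x : ℝ => g (Int.fract (c - x)) := by fun_prop
  rw [← intervalIntegral_comp_fract_sub g c, intervalIntegral.integral_of_le zero_le_one,
    ← map_eq_restrict_of_isUniform hα,
    integral_map (aemeasurable_of_isUniform hα) hm.aestronglyMeasurable]

lemma integrable_comp_fract_sub [IsFiniteMeasure P] (hα : AEMeasurable α P) {g : ℝ → ℝ}
    (hg : Continuous g) (c : ℝ) : Integrable (fun ω => g (Int.fract (c - α ω))) P := by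
  obtain ⟨C, hC⟩ := isCompact_Icc.exists_bound_of_continuousOn (s := Set.Icc (0 : ℝ) 1)
    hg.continuousOn
  have hm : Measurable fun x : ℝ => g (Int.fract (c - x)) := by fun_prop
  exact .of_bound (hm.comp_aemeasurable hα).aestronglyMeasurable C
    (.of_forall fun ω => hC _ ⟨Int.fract_nonneg _, (Int.fract_lt_one _).le⟩)

lemma integrable_comp_of_finite {X : Type*} [Finite X] [IsFiniteMeasure P] {A : Ω → X}
    (hA : ∀ S, MeasurableSet (A ⁻¹' {S})) (h : X → ℝ) : Integrable (fun ω => h (A ω)) P := by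
  let _ : MeasurableSpace X := ⊤
  exact Integrable.of_finite.comp_measurable (g := h) (measurable_to_countable' hA)

end Average

section Guarantee

open MeasureTheory

variable {E V : Type*} [Finite E] [DecidableEq E] {M : Matroid V} {v : E → Finset V} {k : ℕ}
  {f : Finset E → ℝ} {ε d : ℝ} {O : Finset E}

theorem exists_charging (hv : IsParity M v k) (hf : Submodular f) {ι : Type*} [LinearOrder ι]
    {r : E → ι} (hr : r.Injective) (hO : Feasible M v O) {α : ℝ} {A : Finset E}
    (hA : IsOutput f (Feasible M v) ε α A) :
    ∃ p : E → ℝ, (∀ o, 0 ≤ p o) ∧ ∑ o ∈ O, p o ≤ (k + 1) * (f A - f ∅) ∧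
      ∀ o ∈ O, ∀ j, threshold f α (j + 1) ≤ marg f o (A ∪ earlier r O o) →
        threshold f α j ≤ p o := by
  classical
  obtain ⟨i, hreach, hend⟩ := hA
  obtain ⟨X, p, hp⟩ := StateInv.of_reachable hf (antitone_feasible M v)
    (outerInvariant_isPayment (α := α) (ε := ε) hv hf hr hO) hreach
  refine ⟨p, hp.nonneg, hp.sum_le, fun o ho j hm => ?_⟩
  rcases le_or_gt (threshold f α j) 0 with hj | hj
  · exact hj.trans (hp.nonneg o)
  have hpos : 0 < marg f o (A ∪ earlier r O o) := by linarith [two_mul_threshold_succ f α j]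
  have hoA : o ∉ A := fun h => hpos.ne' (marg_of_mem (mem_union_left _ h))
  have hmarg := notMem_union_earlier (r := r) (O := O) hoA
  rcases lt_or_ge j i with hji | hij
  · exact hp.le_of_large o ho hoA j hji hm
  have hoX : ¬ v o ⊆ X := fun h => hend
    ⟨o, hoA, hpos.trans_le (hf _ _ subset_union_left o hmarg), feasible_insert hp.indep h⟩
  exact (threshold_antitone (hpos.trans_le (marg_le_maxMarg hf hmarg)) hij).trans
    (hp.le_of_displaced o ho hoA hoX)

theorem exists_weights (hv : IsParity M v k) (hf : Submodular f) (hO : Feasible M v O)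
    (hOf : StrictlyDownMonotone f O) (hd : 1 ≤ d) :
    ∃ w : E → ℝ, ∑ o ∈ O, w o = f O - f ∅ ∧ ∀ α A, 0 < α → IsOutput f (Feasible M v) ε α A →
      ∑ o ∈ O, w o * guaranteedShare d (Int.fract (Real.logb 2 (w o / maxMarg f) - α)) +
        d * margSet f A O ≤ (k + d + 1) * (f A - f ∅) := by
  obtain ⟨r, hr⟩ := Countable.exists_injective_nat E
  have hnot : ∀ o, o ∉ earlier r O o := fun o h => notMem_erase o O (earlier_subset_erase r O o h)
  have hwpos : ∀ o ∈ O, 0 < marg f o (earlier r O o) := fun o ho =>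
    (hOf o ho).trans_le (hf _ _ (earlier_subset_erase r O o) o (notMem_erase o O))
  have hsum := sum_marg_union_earlier hr f
  refine ⟨fun o => marg f o (earlier r O o), by simpa using hsum ∅ O, fun α A hα hA => ?_⟩
  obtain ⟨p, hp0, hp, hpay⟩ := exists_charging hv hf hr hO hA
  have hloss : ∀ o ∈ O, marg f o (A ∪ earlier r O o) ≤ marg f o (earlier r O o) := by
    intro o ho
    by_cases hoA : o ∈ A
    · exact (marg_of_mem (mem_union_left _ hoA)).trans_le (hwpos o ho).le
    · exact hf _ _ subset_union_right o (notMem_union_earlier hoA)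
  have hshare := sum_le_sum fun o ho => mul_guaranteedShare_le hd (hloss o ho) (hwpos o ho)
    (marg_le_maxMarg hf (hnot o)) hα (hp0 o) (hpay o ho)
  have htotal : ∑ o ∈ O, (marg f o (earlier r O o) - marg f o (A ∪ earlier r O o)) =
      f A - f ∅ - margSet f A O := by
    have h := hsum ∅ O
    simp only [empty_union] at h
    rw [sum_sub_distrib, h, hsum, margSet, union_comm]
    ring
  rw [sum_add_distrib, ← mul_sum, htotal] at hshare
  linarith

variable {Ω : Type*} [MeasurableSpace Ω] {P : Measure Ω} [IsProbabilityMeasure P] {α : Ω → ℝ}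

theorem le_integral_output (hv : IsParity M v k) (hf : Submodular f) (hf0 : 0 ≤ f ∅)
    (hα : pdf.IsUniform α (Set.Ioc 0 1) P volume) {A : Ω → Finset E}
    (hA : ∀ S, MeasurableSet (A ⁻¹' {S}))
    (hout : ∀ᵐ ω ∂P, IsOutput f (Feasible M v) ε (α ω) (A ω)) (hd : 1 ≤ d)
    (hO : Feasible M v O) (hOf : StrictlyDownMonotone f O) :
    d * Real.logb 2 (1 + 1 / d) * f O + d * ∫ ω, margSet f (A ω) O ∂P ≤
      (k + d + 1) * ∫ ω, f (A ω) ∂P := by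
  obtain ⟨w, hw, hpoint⟩ := exists_weights (ε := ε) hv hf hO hOf hd
  have hintA := integrable_comp_of_finite (P := P) hA
  have hshare : ∀ o ∈ O, Integrable (fun ω => w o *
      guaranteedShare d (Int.fract (Real.logb 2 (w o / maxMarg f) - α ω))) P := fun o _ =>
    (integrable_comp_fract_sub (aemeasurable_of_isUniform hα) (continuous_guaranteedShare d)
      _).const_mul (w o)
  have hsum : ∫ ω, ∑ o ∈ O, w o * guaranteedShare d
      (Int.fract (Real.logb 2 (w o / maxMarg f) - α ω)) ∂P =
        (f O - f ∅) * (d * Real.logb 2 (1 + 1 / d)) := by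
    rw [integral_finsetSum O hshare, ← hw, sum_mul]
    refine sum_congr rfl fun o _ => ?_
    rw [integral_const_mul, integral_comp_fract_sub_of_isUniform hα
      (continuous_guaranteedShare d).measurable, integral_guaranteedShare hd]
  have hmean := integral_mono_ae ((integrable_finsetSum O hshare).add
    ((hintA fun S => margSet f S O).const_mul d))
    (((hintA f).sub (integrable_const (f ∅))).const_mul (k + d + 1)) <| by
      filter_upwards [hout, ae_pos_of_isUniform hα] with ω hω hpos using hpoint _ _ hpos hω
  simp only [Pi.add_apply, Pi.sub_apply] at hmean
  rw [integral_add (integrable_finsetSum O hshare) ((hintA fun S => margSet f S O).const_mul d),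
    hsum, integral_const_mul, integral_const_mul, integral_sub (hintA f) (integrable_const _),
    integral_const, probReal_univ, one_smul] at hmean
  have hfactor : d * Real.logb 2 (1 + 1 / d) ≤ k + d + 1 := by
    have := mul_le_of_le_one_right (by linarith : 0 ≤ d) (logb_two_one_add_one_div_le_one hd)
    linarith [k.cast_nonneg (α := ℝ)]
  linarith [mul_le_mul_of_nonneg_right hfactor hf0]

end Guarantee

end MatroidParity

theorem mainTheorem3_general {E V Ω : Type*} [Finite E] [DecidableEq E]
    (k : ℕ) (M : Matroid V) (v : E → Finset V) (hv : MatroidParity.IsParity M v k)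
    (f : Finset E → ℝ) (hf : MatroidParity.Submodular f) (hf0 : 0 ≤ f ∅) (ε : ℝ) (hε : 0 < ε) :
    (∀ a > 0, MatroidParity.Terminates f (MatroidParity.Feasible M v) ε a) ∧
    ∀ [MeasurableSpace Ω] (P : MeasureTheory.Measure Ω) [MeasureTheory.IsProbabilityMeasure P]
      (α : Ω → ℝ) (_ : MeasureTheory.pdf.IsUniform α (Set.Ioc 0 1) P MeasureTheory.volume)
      (A : Ω → Finset E) (_ : ∀ S, MeasurableSet (A ⁻¹' {S}))
      (_ : ∀ᵐ ω ∂P, MatroidParity.IsOutput f (MatroidParity.Feasible M v) ε (α ω) (A ω))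
      (d : ℝ) (_ : 1 ≤ d)
      (O : Finset E) (_ : MatroidParity.Feasible M v O)
      (_ : MatroidParity.StrictlyDownMonotone f O),
      d * Real.logb 2 (1 + 1 / d) * f O + d * ∫ ω, MatroidParity.margSet f (A ω) O ∂P
        ≤ (k + d + 1) * ∫ ω, f (A ω) ∂P :=
  ⟨fun _ ha => MatroidParity.terminates hf (MatroidParity.antitone_feasible M v) hε ha,
    fun _ _ _ hα _ hA hout _ hd _ hO hOf =>
      MatroidParity.le_integral_output hv hf hf0 hα hA hout hd hO hOf⟩

theorem mainTheorem3 {E V Ω : Type*} [Fintype E] [DecidableEq E]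
    (k : ℕ) (M : Matroid V) (v : E → Finset V) (hv : MatroidParity.IsParity M v k)
    (f : Finset E → ℝ) (hf : MatroidParity.Submodular f) (hf0 : ∀ S, 0 ≤ f S)
    (ε : ℝ) (hε0 : 0 < ε) (hε1 : ε < 1) :
    (∀ a ∈ Set.Ioc (0 : ℝ) 1,
      MatroidParity.Terminates f (MatroidParity.Feasible M v) ε a) ∧
    ∀ [MeasurableSpace Ω] (P : MeasureTheory.Measure Ω) [MeasureTheory.IsProbabilityMeasure P]
      (α : Ω → ℝ) (_ : MeasureTheory.pdf.IsUniform α (Set.Ioc 0 1) P MeasureTheory.volume)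
      (A : Ω → Finset E) (_ : ∀ S, MeasurableSet (A ⁻¹' {S}))
      (_ : ∀ᵐ ω ∂P, MatroidParity.IsOutput f (MatroidParity.Feasible M v) ε (α ω) (A ω))
      (d : ℝ) (_ : 2 ≤ d)
      (O : Finset E) (_ : MatroidParity.Feasible M v O)
      (_ : MatroidParity.StrictlyDownMonotone f O),
      ((1 - 1 / d) / (2 * Real.log 2) + (d + 1) / (2 * d)) * f O
          + d * ∫ ω, MatroidParity.margSet f (A ω) O ∂P
        ≤ (k + d + 1 + 2 * ε) * ∫ ω, f (A ω) ∂P := by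
  obtain ⟨hterm, hmain⟩ := mainTheorem3_general (Ω := Ω) k M v hv f hf (hf0 ∅) ε hε0
  refine ⟨fun a ha => hterm a ha.1, fun P _ α hα A hA hout d hd O hO hOf => ?_⟩
  have hfactor := mul_le_mul_of_nonneg_right (MatroidParity.approximation_factor_le hd) (hf0 O)
  have hmean : 0 ≤ ε * ∫ ω, f (A ω) ∂P :=
    mul_nonneg hε0.le (MeasureTheory.integral_nonneg fun ω => hf0 (A ω))
  linarith [hmain P α hα A hA hout d (by linarith) O hO hOf]
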